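/- Conventions. Let $E$ be a locally convex Hausdorff space over $\mathbb{C}$ and let $\mathfrak{P}$ be the set of its continuous seminorms. Put $\overline{\mathbb{R}}:=\mathbb{R}\cup\{\pm\infty\}$. For a compact set $K\subset\overline{\mathbb{R}}$ and $n\in\mathbb{N}=\{1,2,\dots\}$ let $U_n(K)\subset\mathbb{C}$ be the union of $\{z : \mathrm{d}(z,K\cap\mathbb{C})<\tfrac1n\}$ (empty if $K\cap\mathbb{C}=\emptyset$), of $\,]n,\infty[\,+i\,]-\tfrac1n,\tfrac1n[\,$ if $\infty\in K$, and of $\,]-\infty,-n[\,+i\,]-\tfrac1n,\tfrac1n[\,$ if $-\infty\in K$; let $S_n(K):=(\mathbb{C}\setminus\overline{U_n(K)})\cap\{|\operatorname{Im}z|<n\}$. For $\Omega\subset\mathbb{C}$ open, $\mathcal{C}^\infty(\Omega,E)$ is the space of infinitely continuously partially differentiable functions $\Omega\to E$, and $\mathcal{O}(\Omega,E)$ is the space of holomorphic functions $\Omega\to E$, i.e. functions having complex derivatives of every order on $\Omega$, with values in $E$ (for locally complete $E$ this is the same as being complex differentiable at every point of $\Omega$). Let $\mathcal{E}^{exp}(\overline{\mathbb{C}}\setminus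 K,E)$ be the space of all $f\in\mathcal{C}^\infty(\mathbb{C}\setminus K,E)$ such that $\sup\{p(\partial^\beta f(z))e^{-|\operatorname{Re}z|/n} : z\in S_n(K),\,|\beta|\le m\}<\infty$ for all $n\in\mathbb{N}$, $m\in\mathbb{N}_0$, $p\in\mathfrak{P}$, and let $\mathcal{O}^{exp}(\overline{\mathbb{C}}\setminus K,E)$ be the space of all $f\in\mathcal{O}(\mathbb{C}\setminus K,E)$ such that $\sup_{z\in S_n(K)}p(f(z))e^{-|\operatorname{Re}z|/n}<\infty$ for all $n\in\mathbb{N}$, $p\in\mathfrak{P}$. The space $E$ is called admissible if for every compact set $K\subset\overline{\mathbb{R}}$ the Cauchy–Riemann operator $\overline\partial=\tfrac12(\partial_x+i\partial_y)\colon\mathcal{E}^{exp}(\overline{\mathbb{C}}\setminus K,E)\to\mathcal{E}^{exp}(\overline{\mathbb{C}}\setminus K,E)$ is surjective. For a closed set $A\subset\mathbb{R}$ let $\mathcal{B}(A,E):=\mathcal{O}(\mathbb{C}\setminus A,E)/\mathcal{O}(\mathbb{C},E)$ be the space of $E$-valued hyperfunctions with support in $A$. In all quotients the denominator is embedded in the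 numerator by restriction. Theorem. Let $E$ be an admissible locally convex Hausdorff space over $\mathbb{C}$ and let $a\in\mathbb{R}$. Then the canonical (restriction) maps \[ \mathcal{R}_{[a,\infty[}\colon \mathcal{O}^{exp}(\overline{\mathbb{C}}\setminus[a,\infty],E)/\mathcal{O}^{exp}(\overline{\mathbb{C}}\setminus\{\infty\},E)\to\mathcal{B}([a,\infty[,E),\quad [F]\mapsto[F], \] and \[ \mathcal{R}_{]-\infty,a]}\colon \mathcal{O}^{exp}(\overline{\mathbb{C}}\setminus[-\infty,a],E)/\mathcal{O}^{exp}(\overline{\mathbb{C}}\setminus\{-\infty\},E)\to\mathcal{B}(]-\infty,a],E),\quad [F]\mapsto[F], \] are linear isomorphisms. Thus every $E$-valued hyperfunction with support in $[a,\infty[$ (respectively $]-\infty,a]$) extends to an element of $\mathcal{O}^{exp}(\overline{\mathbb{C}}\setminus[a,\infty],E)/\mathcal{O}^{exp}(\overline{\mathbb{C}},E)$ (respectively $\mathcal{O}^{exp}(\overline{\mathbb{C}}\setminus[-\infty,a],E)/\mathcal{O}^{exp}(\overline{\mathbb{C}},E)$), uniquely up to an element represented in $\mathcal{O}^{exp}(\overline{\mathbb{C}}\setminus\{\infty\},E)$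 (respectively $\mathcal{O}^{exp}(\overline{\mathbb{C}}\setminus\{-\infty\},E)$). -/

import Mathlib

open Filter Topology TopologicalSpace

set_option linter.unusedSectionVars false

noncomputable section

namespace Hyperfunction

/-- The real points `K ∩ ℝ` of a compact subset `K` of the extended real line. -/
def finitePart (K : Compacts EReal) : Closeds ℝ :=
  ⟨Real.toEReal ⁻¹' (K : Set EReal), K.isCompact.isClosed.preimage continuous_coe_real_ereal⟩

/-- The open set `ℂ ∖ A`, for a closed subset `A` of the real line. -/
def cutPlane (A : Closeds ℝ) : Opens ℂ :=
  ⟨(Complex.ofReal '' (A : Set ℝ))ᶜ,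
    (Complex.isometry_ofReal.isClosedEmbedding.isClosedMap _ A.isClosed).isOpen_compl⟩

/-- The neighbourhood `U_n(K)` of a compact subset `K` of the extended real line: the points of `ℂ`
at distance less than `1/n` from `K ∩ ℂ`, and a half-strip around each infinite point of `K`. -/
def nhdU (n : ℕ) (K : Compacts EReal) : Set ℂ :=
  Metric.thickening (1 / (n : ℝ)) (Complex.ofReal '' (finitePart K : Set ℝ)) ∪
    {z | ⊤ ∈ K ∧ (n : ℝ) < z.re ∧ |z.im| < 1 / (n : ℝ)} ∪
    {z | ⊥ ∈ K ∧ z.re < -(n : ℝ) ∧ |z.im| < 1 / (n : ℝ)}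

/-- The set `S_n(K) = (ℂ ∖ closure U_n(K)) ∩ {|Im z| < n}`. -/
def stripS (n : ℕ) (K : Compacts EReal) : Set ℂ :=
  (closure (nhdU n K))ᶜ ∩ {z | |z.im| < (n : ℝ)}

section Spaces

variable {E : Type*} [AddCommGroup E]

/-- Extension by zero of a function on `Ω` to the whole plane. As `Ω` is open, difference quotients
of this extension at points of `Ω` involve for small increments only the values on `Ω`. -/
def ext0 {Ω : Opens ℂ} (f : Ω → E) : ℂ → E :=
  Function.extend Subtype.val f 0

theorem ext0_coe {Ω : Opens ℂ} (f : Ω → E) (z : Ω) : ext0 f z = f z :=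
  Subtype.val_injective.extend_apply f 0 z

variable [Module ℂ E] [TopologicalSpace E]

/-- `f'` is the derivative of `f : Ω → E` in the real direction `v` at every point of `Ω`; so `v = 1`
gives the partial derivative in `x = Re z`, and `v = i` the partial derivative in `y = Im z`. -/
def HasPartial {Ω : Opens ℂ} (v : ℂ) (f f' : Ω → E) : Prop :=
  ∀ z : Ω, Tendsto (fun t : ℝ => ((t : ℂ)⁻¹) • (ext0 f (z + t * v) - f z)) (𝓝[≠] 0) (𝓝 (f' z))

/-- `f'` is the complex derivative of `f : Ω → E` at every point of `Ω`. -/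
def HasComplexDeriv {Ω : Opens ℂ} (f f' : Ω → E) : Prop :=
  ∀ z : Ω, Tendsto (fun h : ℂ => h⁻¹ • (ext0 f (z + h) - f z)) (𝓝[≠] 0) (𝓝 (f' z))

/-- `D i j` is the partial derivative `∂ₓⁱ ∂ᵧʲ f`, and all of these exist and are continuous on `Ω`.
Thus `f ∈ C^∞(Ω, E)` means that such a (necessarily unique) family `D` exists. -/
structure IsJet {Ω : Opens ℂ} (f : Ω → E) (D : ℕ → ℕ → Ω → E) : Prop where
  zero : D 0 0 = f
  cont : ∀ i j, Continuous (D i j)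
  partial_x : ∀ i j, HasPartial 1 (D i j) (D (i + 1) j)
  partial_y : ∀ i j, HasPartial Complex.I (D i j) (D i (j + 1))

/-- `f = ∂̄ g = (∂ₓ g + i ∂ᵧ g) / 2` on `Ω`. -/
def IsDbar {Ω : Opens ℂ} (g f : Ω → E) : Prop :=
  ∃ gx gy : Ω → E, HasPartial 1 g gx ∧ HasPartial Complex.I g gy ∧
    ∀ z, f z = (1 / 2 : ℂ) • (gx z + Complex.I • gy z)

/-- `f ∈ E^exp(ℂ̄ ∖ K, E)`: `f` is smooth on `ℂ ∖ K`, and for all `n ≥ 1`, `m` and every continuous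
seminorm `p`, the numbers `p (∂^β f(z)) exp(-|Re z|/n)`, `|β| ≤ m`, are bounded on `S_n(K)`. -/
def IsSmoothExp (K : Compacts EReal) (f : cutPlane (finitePart K) → E) : Prop :=
  ∃ D : ℕ → ℕ → cutPlane (finitePart K) → E, IsJet f D ∧
    ∀ n : ℕ, 1 ≤ n → ∀ m : ℕ, ∀ p : Seminorm ℂ E, Continuous p →
      ∃ C : ℝ, ∀ z : cutPlane (finitePart K), (z : ℂ) ∈ stripS n K → ∀ i j, i + j ≤ m →
        p (D i j z) * Real.exp (-(1 / (n : ℝ)) * |(z : ℂ).re|) ≤ C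

variable (E) in
/-- `E` is admissible: `∂̄ : E^exp(ℂ̄ ∖ K, E) → E^exp(ℂ̄ ∖ K, E)` is surjective for every compact
subset `K` of the extended real line. -/
def Admissible : Prop :=
  ∀ K : Compacts EReal, ∀ f : cutPlane (finitePart K) → E, IsSmoothExp K f →
    ∃ g : cutPlane (finitePart K) → E, IsSmoothExp K g ∧ IsDbar g f

theorem ext0_add {Ω : Opens ℂ} (f g : Ω → E) (w : ℂ) :
    ext0 (f + g) w = ext0 f w + ext0 g w := by
  by_cases h : w ∈ Ω
  · simpa using (ext0_coe (f + g) ⟨w, h⟩).trans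
      (congrArg₂ (· + ·) (ext0_coe f ⟨w, h⟩) (ext0_coe g ⟨w, h⟩)).symm
  · have h0 : ¬ ∃ a : Ω, (a : ℂ) = w := by rintro ⟨a, rfl⟩; exact h a.2
    simp [ext0, Function.extend_apply' _ _ _ h0]

theorem ext0_smul {Ω : Opens ℂ} (c : ℂ) (f : Ω → E) (w : ℂ) :
    ext0 (c • f) w = c • ext0 f w := by
  by_cases h : w ∈ Ω
  · simpa using (ext0_coe (c • f) ⟨w, h⟩).trans (congrArg (c • ·) (ext0_coe f ⟨w, h⟩)).symm
  · have h0 : ¬ ∃ a : Ω, (a : ℂ) = w := by rintro ⟨a, rfl⟩; exact h a.2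
    simp [ext0, Function.extend_apply' _ _ _ h0]

/-- Restriction of functions from `Ω` to a smaller open set `Ω₁`. -/
def restrictFun {Ω Ω₁ : Opens ℂ} (h : Ω₁ ≤ Ω) : (Ω → E) →ₗ[ℂ] (Ω₁ → E) where
  toFun f := fun z => f ⟨z, h z.2⟩
  map_add' _ _ := rfl
  map_smul' _ _ := rfl

theorem HasComplexDeriv.restrict {Ω Ω₁ : Opens ℂ} (h : Ω₁ ≤ Ω) {f f' : Ω → E}
    (hf : HasComplexDeriv f f') : HasComplexDeriv (restrictFun h f) (restrictFun h f') := by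
  intro z
  refine (hf ⟨z, h z.2⟩).congr' ?_
  have hc : Tendsto (fun w : ℂ => (z : ℂ) + w) (𝓝 0) (𝓝 (z : ℂ)) := by
    have : Continuous fun w : ℂ => (z : ℂ) + w := by fun_prop
    simpa using this.tendsto 0
  have hev : ∀ᶠ w : ℂ in 𝓝[≠] 0, (z : ℂ) + w ∈ Ω₁ :=
    (hc.eventually (Ω₁.isOpen.mem_nhds z.2)).filter_mono nhdsWithin_le_nhds
  filter_upwards [hev] with w hw
  have e₁ : ext0 f ((z : ℂ) + w) = f ⟨(z : ℂ) + w, h hw⟩ := ext0_coe f ⟨_, h hw⟩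
  have e₂ : ext0 (restrictFun h f) ((z : ℂ) + w) = f ⟨(z : ℂ) + w, h hw⟩ :=
    ext0_coe (restrictFun h f) ⟨_, hw⟩
  rw [e₁, e₂]
  rfl

variable [IsTopologicalAddGroup E] [ContinuousSMul ℂ E]

theorem HasComplexDeriv.add {Ω : Opens ℂ} {f g f' g' : Ω → E} (hf : HasComplexDeriv f f')
    (hg : HasComplexDeriv g g') : HasComplexDeriv (f + g) (f' + g') := by
  intro z
  refine ((hf z).add (hg z)).congr fun w => ?_
  rw [ext0_add, Pi.add_apply, ← smul_add]
  congr 1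
  abel

theorem HasComplexDeriv.smul {Ω : Opens ℂ} (c : ℂ) {f f' : Ω → E} (hf : HasComplexDeriv f f') :
    HasComplexDeriv (c • f) (c • f') := by
  intro z
  refine ((hf z).const_smul c).congr fun w => ?_
  rw [ext0_smul, Pi.smul_apply, ← smul_sub, smul_comm]

theorem hasComplexDeriv_zero {Ω : Opens ℂ} : HasComplexDeriv (0 : Ω → E) 0 := by
  intro z
  have h : ∀ w : ℂ, ext0 (0 : Ω → E) w = 0 := fun w => by
    simpa using ext0_smul (0 : ℂ) (0 : Ω → E) w
  simp only [h, Pi.zero_apply, sub_zero, smul_zero]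
  exact tendsto_const_nhds

variable (E)

/-- The space `O(Ω, E)` of `E`-valued holomorphic functions on `Ω`: the functions that are
infinitely complex differentiable on `Ω`, with all complex derivatives `D n` taking values in `E`.
(If `E` is locally complete, then one complex derivative is enough.) -/
def holo (Ω : Opens ℂ) : Submodule ℂ (Ω → E) where
  carrier := {f | ∃ D : ℕ → Ω → E, D 0 = f ∧ ∀ n, HasComplexDeriv (D n) (D (n + 1))}
  zero_mem' := ⟨fun _ => 0, rfl, fun _ => hasComplexDeriv_zero⟩
  add_mem' := by
    rintro f g ⟨D, rfl, hD⟩ ⟨D₁, rfl, hD₁⟩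
    exact ⟨fun n => D n + D₁ n, rfl, fun n => (hD n).add (hD₁ n)⟩
  smul_mem' := by
    rintro c f ⟨D, rfl, hD⟩
    exact ⟨fun n => c • D n, rfl, fun n => (hD n).smul c⟩

/-- The space `O^exp(ℂ̄ ∖ K, E)` of slowly increasing holomorphic functions outside `K`: for all
`n ≥ 1` and every continuous seminorm `p`, the function `p (f(z)) exp(-|Re z|/n)` is bounded
on `S_n(K)`. -/
def holoExp (K : Compacts EReal) : Submodule ℂ (cutPlane (finitePart K) → E) where
  carrier := {f | f ∈ holo E (cutPlane (finitePart K)) ∧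
    ∀ n : ℕ, 1 ≤ n → ∀ p : Seminorm ℂ E, Continuous p →
      ∃ C : ℝ, ∀ z : cutPlane (finitePart K), (z : ℂ) ∈ stripS n K →
        p (f z) * Real.exp (-(1 / (n : ℝ)) * |(z : ℂ).re|) ≤ C}
  zero_mem' := ⟨zero_mem _, fun n _ p _ => ⟨0, fun z _ => by simp⟩⟩
  add_mem' := by
    rintro f g ⟨hf, hf'⟩ ⟨hg, hg'⟩
    refine ⟨add_mem hf hg, fun n hn p hp => ?_⟩
    obtain ⟨C, hC⟩ := hf' n hn p hp
    obtain ⟨C₁, hC₁⟩ := hg' n hn p hp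
    refine ⟨C + C₁, fun z hz => ?_⟩
    refine le_trans ?_ (add_le_add (hC z hz) (hC₁ z hz))
    rw [← add_mul]
    exact mul_le_mul_of_nonneg_right (map_add_le_add p _ _) (Real.exp_pos _).le
  smul_mem' := by
    rintro c f ⟨hf, hf'⟩
    refine ⟨Submodule.smul_mem _ c hf, fun n hn p hp => ?_⟩
    obtain ⟨C, hC⟩ := hf' n hn p hp
    refine ⟨‖c‖ * C, fun z hz => ?_⟩
    rw [Pi.smul_apply, map_smul_eq_mul, mul_assoc]
    exact mul_le_mul_of_nonneg_left (hC z hz) (norm_nonneg c)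

end Spaces

theorem cutPlane_anti {A B : Closeds ℝ} (h : A ≤ B) : cutPlane B ≤ cutPlane A :=
  Set.compl_subset_compl.2 (Set.image_mono h)

theorem finitePart_mono {L K : Compacts EReal} (h : L ≤ K) : finitePart L ≤ finitePart K :=
  fun _ hx => h hx

theorem nhdU_mono (n : ℕ) {L K : Compacts EReal} (h : L ≤ K) : nhdU n L ⊆ nhdU n K :=
  Set.union_subset_union
    (Set.union_subset_union
      (Metric.thickening_subset_of_subset _ (Set.image_mono (finitePart_mono h)))
      (fun _ hz => ⟨h hz.1, hz.2⟩))
    (fun _ hz => ⟨h hz.1, hz.2⟩)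

theorem stripS_anti (n : ℕ) {L K : Compacts EReal} (h : L ≤ K) : stripS n K ⊆ stripS n L :=
  Set.inter_subset_inter_left _ (Set.compl_subset_compl.2 (closure_mono (nhdU_mono n h)))

section Quotients

variable (E : Type*) [AddCommGroup E] [Module ℂ E] [TopologicalSpace E]
  [IsTopologicalAddGroup E] [ContinuousSMul ℂ E]

theorem restrict_mem_holo {Ω Ω₁ : Opens ℂ} (h : Ω₁ ≤ Ω) {f : Ω → E} (hf : f ∈ holo E Ω) :
    restrictFun h f ∈ holo E Ω₁ := by
  obtain ⟨D, rfl, hD⟩ := hf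
  exact ⟨fun n => restrictFun h (D n), rfl, fun n => (hD n).restrict h⟩

/-- The restriction map `O(Ω, E) → O(Ω₁, E)`, for `Ω₁ ⊆ Ω`. -/
def holoRestrict {Ω Ω₁ : Opens ℂ} (h : Ω₁ ≤ Ω) : holo E Ω →ₗ[ℂ] holo E Ω₁ :=
  (restrictFun h).restrict fun _ hf => restrict_mem_holo E h hf

/-- The restriction map `O^exp(ℂ̄ ∖ L, E) → O^exp(ℂ̄ ∖ K, E)`, for `L ⊆ K`. -/
def holoExpRestrict {L K : Compacts EReal} (h : L ≤ K) : holoExp E L →ₗ[ℂ] holoExp E K :=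
  (restrictFun (cutPlane_anti (finitePart_mono h))).restrict fun _ hf =>
    ⟨restrict_mem_holo E _ hf.1, fun n hn p hp =>
      (hf.2 n hn p hp).imp fun _ hC z hz => hC ⟨z, _⟩ (stripS_anti n h hz)⟩

/-- The restriction map `O^exp(ℂ̄ ∖ K, E) → O(ℂ ∖ A, E)`, for `K ∩ ℝ ⊆ A`. -/
def holoExpToHolo {K : Compacts EReal} {A : Closeds ℝ} (h : finitePart K ≤ A) :
    holoExp E K →ₗ[ℂ] holo E (cutPlane A) :=
  (restrictFun (cutPlane_anti h)).restrict fun _ hf => restrict_mem_holo E _ hf.1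

/-- The space `B(A, E) = O(ℂ ∖ A, E) / O(ℂ, E)` of `E`-valued hyperfunctions with support in the
closed set `A ⊆ ℝ`. -/
abbrev Hyp (A : Closeds ℝ) : Type _ :=
  holo E (cutPlane A) ⧸ (holoRestrict E (le_top : cutPlane A ≤ ⊤)).range

/-- The quotient `O^exp(ℂ̄ ∖ K, E) / O^exp(ℂ̄ ∖ L, E)`, for `L ⊆ K`. -/
abbrev ExpQuot {L K : Compacts EReal} (h : L ≤ K) : Type _ :=
  holoExp E K ⧸ (holoExpRestrict E h).range

/-- The canonical map `O^exp(ℂ̄ ∖ K, E) / O^exp(ℂ̄ ∖ L, E) → B(A, E)`, `[F] ↦ [F]`, for `L ⊆ K`,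
`L ∩ ℝ = ∅` and `K ∩ ℝ ⊆ A`. -/
def restrictionMap {L K : Compacts EReal} {A : Closeds ℝ} (hLK : L ≤ K) (hL : finitePart L = ⊥)
    (hKA : finitePart K ≤ A) : ExpQuot E hLK →ₗ[ℂ] Hyp E A :=
  Submodule.mapQ _ _ (holoExpToHolo E hKA) <| by
    rintro _ ⟨G, rfl⟩
    have hΩ : (⊤ : Opens ℂ) ≤ cutPlane (finitePart L) := by
      intro z _
      simp [hL, cutPlane]
    exact ⟨⟨restrictFun hΩ G.1, restrict_mem_holo E hΩ G.2.1⟩, rfl⟩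

end Quotients

/-- The compact set `[a, ∞]`. -/
def rayRight (a : ℝ) : Compacts EReal := ⟨Set.Icc (a : EReal) ⊤, isCompact_Icc⟩

/-- The compact set `[-∞, a]`. -/
def rayLeft (a : ℝ) : Compacts EReal := ⟨Set.Icc ⊥ (a : EReal), isCompact_Icc⟩

/-- The compact set `{∞}`. -/
def pointTop : Compacts EReal := ⟨{⊤}, isCompact_singleton⟩

/-- The compact set `{-∞}`. -/
def pointBot : Compacts EReal := ⟨{⊥}, isCompact_singleton⟩

/-- The closed half-line `[a, ∞[`. -/
def halfLineRight (a : ℝ) : Closeds ℝ := ⟨Set.Ici a, isClosed_Ici⟩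

/-- The closed half-line `]-∞, a]`. -/
def halfLineLeft (a : ℝ) : Closeds ℝ := ⟨Set.Iic a, isClosed_Iic⟩

theorem pointTop_le (a : ℝ) : pointTop ≤ rayRight a := by
  rintro _ rfl
  exact ⟨le_top, le_rfl⟩

theorem pointBot_le (a : ℝ) : pointBot ≤ rayLeft a := by
  rintro _ rfl
  exact ⟨le_rfl, bot_le⟩

theorem finitePart_pointTop : finitePart pointTop = ⊥ := by
  ext x
  exact ⟨fun h => (EReal.coe_ne_top x h).elim, fun h => h.elim⟩

theorem finitePart_pointBot : finitePart pointBot = ⊥ := by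
  ext x
  exact ⟨fun h => (EReal.coe_ne_bot x h).elim, fun h => h.elim⟩

theorem finitePart_rayRight (a : ℝ) : finitePart (rayRight a) = halfLineRight a := by
  ext x
  exact ⟨fun h => EReal.coe_le_coe_iff.1 h.1, fun h => ⟨EReal.coe_le_coe_iff.2 h, le_top⟩⟩

theorem finitePart_rayLeft (a : ℝ) : finitePart (rayLeft a) = halfLineLeft a := by
  ext x
  exact ⟨fun h => EReal.coe_le_coe_iff.1 h.2, fun h => ⟨bot_le, EReal.coe_le_coe_iff.2 h⟩⟩

section Restriction

variable (E : Type*) [AddCommGroup E] [Module ℂ E] [TopologicalSpace E]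
  [IsTopologicalAddGroup E] [ContinuousSMul ℂ E]

/-- The canonical map `O^exp(ℂ̄ ∖ [a,∞], E) / O^exp(ℂ̄ ∖ {∞}, E) → B([a,∞[, E)`, `[F] ↦ [F]`. -/
def restrictionRight (a : ℝ) : ExpQuot E (pointTop_le a) →ₗ[ℂ] Hyp E (halfLineRight a) :=
  restrictionMap E (pointTop_le a) finitePart_pointTop (finitePart_rayRight a).le

/-- The canonical map `O^exp(ℂ̄ ∖ [-∞,a], E) / O^exp(ℂ̄ ∖ {-∞}, E) → B(]-∞,a], E)`, `[F] ↦ [F]`. -/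
def restrictionLeft (a : ℝ) : ExpQuot E (pointBot_le a) →ₗ[ℂ] Hyp E (halfLineLeft a) :=
  restrictionMap E (pointBot_le a) finitePart_pointBot (finitePart_rayLeft a).le

end Restriction

end Hyperfunction

end

/-! Write K for the closed ray, L for its infinite end point and A = K ∩ ℝ.

Surjectivity is a cut-off argument in the manner of Cousin. Let f be holomorphic off A, and let ψ be
smooth, equal to 1 near A, with a support that meets each S_n(L) in a bounded set. Then (∂̄ψ)f
extends by zero across A to a smooth function on ℂ. However fast f grows at infinity, this function
lies in E^exp(ℂ̄ ∖ L, E), since on each S_n(L) it lives on a bounded set. Admissibility for L gives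
h in the same space with ∂̄h = (∂̄ψ)f. Now F = ψf - h is holomorphic off A and slowly increasing,
while f - F = (1 - ψ)f + h is entire, so [F] = [f]. The support condition is met by letting the
support of ψ become exponentially thin at the end point: eventually it runs inside the half-strip
that S_n(L) omits.

Injectivity needs no ∂̄-equation. If F extends to an entire G, the growth of G is controlled by F on
S_n(K), and S_n(L) ∖ S_n(K) is bounded, so G is bounded there by continuity.

The two halves are `restrictionMap_surjective` and `restrictionMap_injective`. They rest on a
Leibniz calculus for families of partial derivatives (`JetAt.leibniz`) and on
`complexDerivAt_of_jetAt`: smoothness and the Cauchy–Riemann equation give complex derivatives of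
all orders with values in E. The latter uses only seminorm estimates, so no completeness of E
enters. -/

noncomputable section

namespace Hyperfunction

/-! ### Derivatives at a point, for functions on the whole plane. -/

section Pointwise

variable {E : Type*} [AddCommGroup E] [Module ℂ E] [TopologicalSpace E]

/-- `e` is the derivative of `F` at `z` in the real direction `v`. -/
def PartialAt (v : ℂ) (F : ℂ → E) (e : E) (z : ℂ) : Prop :=
  Tendsto (fun t : ℝ => ((t : ℂ)⁻¹) • (F (z + t * v) - F z)) (𝓝[≠] 0) (𝓝 e)

/-- `e` is the complex derivative of `F` at `z`. -/
def ComplexDerivAt (F : ℂ → E) (e : E) (z : ℂ) : Prop :=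
  Tendsto (fun h : ℂ => h⁻¹ • (F (z + h) - F z)) (𝓝[≠] 0) (𝓝 e)

theorem tendsto_add_real_mul (v z : ℂ) : Tendsto (fun t : ℝ => z + t * v) (𝓝 0) (𝓝 z) := by
  have : Continuous fun t : ℝ => z + (t : ℂ) * v := by fun_prop
  simpa using this.tendsto 0

theorem tendsto_add_complex (z : ℂ) : Tendsto (fun h : ℂ => z + h) (𝓝 0) (𝓝 z) := by
  have : Continuous fun h : ℂ => z + h := by fun_prop
  simpa using this.tendsto 0

theorem PartialAt.congr {v z : ℂ} {F G : ℂ → E} {e : E} (hF : PartialAt v F e z)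
    (h : F =ᶠ[𝓝 z] G) : PartialAt v G e z := by
  refine Tendsto.congr' ?_ hF
  filter_upwards [((tendsto_add_real_mul v z).eventually h).filter_mono nhdsWithin_le_nhds]
    with t ht
  rw [ht, h.self_of_nhds]

theorem ComplexDerivAt.congr {z : ℂ} {F G : ℂ → E} {e : E} (hF : ComplexDerivAt F e z)
    (h : F =ᶠ[𝓝 z] G) : ComplexDerivAt G e z := by
  refine Tendsto.congr' ?_ hF
  filter_upwards [((tendsto_add_complex z).eventually h).filter_mono nhdsWithin_le_nhds]
    with t ht
  rw [ht, h.self_of_nhds]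

theorem ext0_restrict_eventuallyEq {Ω : Opens ℂ} (F : ℂ → E) {z : ℂ} (hz : z ∈ Ω) :
    F =ᶠ[𝓝 z] ext0 (fun w : Ω => F w) := by
  filter_upwards [Ω.isOpen.mem_nhds hz] with w hw
  exact (ext0_coe (fun w : Ω => F w) ⟨w, hw⟩).symm

theorem hasPartial_of_partialAt {Ω : Opens ℂ} {v : ℂ} {F F' : ℂ → E}
    (h : ∀ z ∈ Ω, PartialAt v F (F' z) z) :
    HasPartial v (fun z : Ω => F z) (fun z : Ω => F' z) := by
  intro z
  have := (h z z.2).congr (ext0_restrict_eventuallyEq F z.2)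
  rwa [PartialAt, ext0_coe (fun w : Ω => F w) z] at this

theorem HasPartial.partialAt {Ω : Opens ℂ} {v : ℂ} {f f' : Ω → E} (h : HasPartial v f f') {z : ℂ}
    (hz : z ∈ Ω) : PartialAt v (ext0 f) (ext0 f' z) z := by
  have := h ⟨z, hz⟩
  rwa [← ext0_coe f, ← ext0_coe f'] at this

theorem hasComplexDeriv_of_complexDerivAt {Ω : Opens ℂ} {F F' : ℂ → E}
    (h : ∀ z ∈ Ω, ComplexDerivAt F (F' z) z) :
    HasComplexDeriv (fun z : Ω => F z) (fun z : Ω => F' z) := by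
  intro z
  have := (h z z.2).congr (ext0_restrict_eventuallyEq F z.2)
  rwa [ComplexDerivAt, ext0_coe (fun w : Ω => F w) z] at this

theorem HasComplexDeriv.complexDerivAt {Ω : Opens ℂ} {f f' : Ω → E} (h : HasComplexDeriv f f')
    {z : ℂ} (hz : z ∈ Ω) : ComplexDerivAt (ext0 f) (ext0 f' z) z := by
  have := h ⟨z, hz⟩
  rwa [← ext0_coe f, ← ext0_coe f'] at this

theorem PartialAt.unique [T2Space E] {v z : ℂ} {F : ℂ → E} {e e' : E} (h : PartialAt v F e z)
    (h' : PartialAt v F e' z) : e = e' :=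
  tendsto_nhds_unique h h'

variable [IsTopologicalAddGroup E] [ContinuousSMul ℂ E]

theorem PartialAt.add {v z : ℂ} {F G : ℂ → E} {e e' : E} (hF : PartialAt v F e z)
    (hG : PartialAt v G e' z) : PartialAt v (F + G) (e + e') z := by
  refine (Tendsto.add hF hG).congr fun t => ?_
  rw [← smul_add, Pi.add_apply, Pi.add_apply]
  congr 1
  abel

theorem PartialAt.const_smul (c : ℂ) {v z : ℂ} {F : ℂ → E} {e : E} (hF : PartialAt v F e z) :
    PartialAt v (c • F) (c • e) z := by
  refine (Tendsto.const_smul hF c).congr fun t => ?_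
  rw [Pi.smul_apply, Pi.smul_apply, ← smul_sub, smul_comm]

theorem PartialAt.smul {v z c : ℂ} {χ : ℂ → ℂ} {F : ℂ → E} {e : E} (hχ : PartialAt v χ c z)
    (hc : ContinuousAt χ z) (hF : PartialAt v F e z) :
    PartialAt v (fun w => χ w • F w) (c • F z + χ z • e) z := by
  have h₁ : Tendsto (fun t : ℝ => χ (z + t * v)) (𝓝[≠] 0) (𝓝 (χ z)) :=
    (hc.tendsto.comp (tendsto_add_real_mul v z)).mono_left nhdsWithin_le_nhds
  refine ((Tendsto.smul hχ (tendsto_const_nhds (x := F z))).add (h₁.smul hF)).congr fun t => ?_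
  rw [smul_comm (χ (z + t * v)), smul_assoc, ← smul_add, sub_smul, smul_sub]
  congr 1
  abel

theorem ComplexDerivAt.partialAt {z v : ℂ} (hv : v ≠ 0) {F : ℂ → E} {e : E}
    (hF : ComplexDerivAt F e z) : PartialAt v F (v • e) z := by
  have hφ : Tendsto (fun t : ℝ => (t : ℂ) * v) (𝓝[≠] 0) (𝓝[≠] 0) := by
    refine tendsto_nhdsWithin_of_tendsto_nhds_of_eventually_within _ ?_ ?_
    · have := tendsto_add_real_mul v 0
      simp only [zero_add] at this
      exact this.mono_left nhdsWithin_le_nhds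
    · filter_upwards [self_mem_nhdsWithin] with t ht
      exact mul_ne_zero (Complex.ofReal_ne_zero.2 ht) hv
  refine ((Tendsto.comp hF hφ).const_smul v).congr fun t => ?_
  simp only [Function.comp_apply, smul_smul]
  congr 1
  rw [mul_inv]
  field_simp

theorem ComplexDerivAt.continuousAt {z : ℂ} {F : ℂ → E} {e : E} (hF : ComplexDerivAt F e z) :
    ContinuousAt F z := by
  have h₁ : Tendsto (fun h : ℂ => F (z + h)) (𝓝[≠] 0) (𝓝 (F z)) := by
    have h0 : Tendsto (fun h : ℂ => h) (𝓝[≠] 0) (𝓝 0) := tendsto_id.mono_left nhdsWithin_le_nhds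
    have := (h0.smul hF).add_const (F z)
    rw [zero_smul, zero_add] at this
    refine this.congr' ?_
    filter_upwards [self_mem_nhdsWithin] with h hh
    rw [smul_smul, mul_inv_cancel₀ hh, one_smul, sub_add_cancel]
  have h₂ : ContinuousAt (fun h : ℂ => F (z + h)) 0 := by
    rw [continuousAt_iff_punctured_nhds]
    simpa using h₁
  have h₃ : ContinuousAt (fun w : ℂ => w - z) z := by fun_prop
  have := ContinuousAt.comp (f := fun w : ℂ => w - z) (x := z) (by simpa using h₂) h₃
  simpa [Function.comp_def] using this

end Pointwise

/-! ### The mean value inequality for continuous seminorms. -/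

section MeanValue

variable {E : Type*} [AddCommGroup E] [Module ℂ E]

/-- Hahn–Banach over ℝ: extend t e ↦ t p(e) from the line ℝe, keeping the bound by p. It reduces
estimates in E to estimates for real functions. -/
theorem exists_dominated_functional (p : Seminorm ℂ E) (e : E) :
    ∃ u : E →ₗ[ℝ] ℝ, u e = p e ∧ ∀ x, |u x| ≤ p x := by
  have hp : ∀ (c : ℝ) (x : E), p (c • x) = |c| * p x := fun c x => by
    rw [← Complex.coe_smul, map_smul_eq_mul, Complex.norm_real, Real.norm_eq_abs]
  by_cases he : e = 0
  · exact ⟨0, by simp [he], fun x => by simp⟩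
  obtain ⟨u, hu, hup⟩ := exists_extension_of_le_sublinear
    (LinearPMap.mkSpanSingleton (K := ℝ) e (p e) he) p
    (fun c hc x => by rw [hp, abs_of_pos hc]) (map_add_le_add p) (by
      rintro ⟨x, hx⟩
      obtain ⟨c, rfl⟩ := Submodule.mem_span_singleton.1 hx
      refine (LinearPMap.mkSpanSingleton'_apply e (p e) _ c hx).trans_le ?_
      rw [hp, RingHom.id_apply, smul_eq_mul]
      exact mul_le_mul_of_nonneg_right (le_abs_self c) (apply_nonneg p e))
  refine ⟨u, ?_, fun x => abs_le.2 ⟨?_, hup x⟩⟩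
  · exact (hu ⟨e, Submodule.mem_span_singleton_self e⟩).trans
      (LinearPMap.mkSpanSingleton_apply ℝ ℝ he (p e))
  · have := hup (-x)
    rw [map_neg, map_neg_eq_map] at this
    linarith

variable [TopologicalSpace E] [IsTopologicalAddGroup E]

/-- Apply the real mean value inequality to u ∘ F along the segment, minus its linear part, where u
is a functional dominated by p. This avoids integrals in E. -/
theorem seminorm_increment_le {p : Seminorm ℂ E} (hp : Continuous p) {F F' : ℂ → E} {v w : ℂ}
    {c : E} {ε t : ℝ} (hF : ∀ τ ∈ Set.uIcc 0 t, PartialAt v F (F' (w + τ * v)) (w + τ * v))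
    (hε : ∀ τ ∈ Set.uIcc 0 t, p (F' (w + τ * v) - c) ≤ ε) :
    p (F (w + t * v) - F w - (t : ℂ) • c) ≤ ε * |t| := by
  -- The functional is chosen to attain p at the very vector to be estimated.
  obtain ⟨u, hu, hup⟩ := exists_dominated_functional p (F (w + t * v) - F w - (t : ℂ) • c)
  have huc : ∀ (s : ℝ) (x : E), u ((s : ℂ) • x) = s * u x := fun s x => by
    rw [Complex.coe_smul, map_smul, smul_eq_mul]
  have hd : ∀ τ ∈ Set.uIcc 0 t, HasDerivAt (fun τ : ℝ => u (F (w + τ * v)) - τ * u c)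
      (u (F' (w + τ * v)) - u c) τ := by
    intro τ hτ
    refine HasDerivAt.sub ?_ (by simpa using (hasDerivAt_id τ).mul_const (u c))
    rw [hasDerivAt_iff_tendsto_slope_zero, tendsto_iff_norm_sub_tendsto_zero]
    have h0 : Tendsto (fun s : ℝ => p ((s : ℂ)⁻¹ • (F (w + τ * v + s * v) - F (w + τ * v)) -
        F' (w + τ * v))) (𝓝[≠] 0) (𝓝 0) := by
      have := (hp.tendsto _).comp ((hF τ hτ).sub_const (F' (w + τ * v)))
      simpa [Function.comp_def] using this
    refine squeeze_zero (fun _ => norm_nonneg _) (fun s => ?_) h0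
    refine le_trans (le_of_eq ?_) (hup _)
    rw [← Complex.ofReal_inv, map_sub, huc, map_sub, Real.norm_eq_abs, smul_eq_mul]
    congr 5
    push_cast
    ring_nf
  have := Convex.norm_image_sub_le_of_norm_hasDerivWithin_le (C := ε) (s := Set.uIcc 0 t) (x := 0)
    (y := t) (fun τ hτ => (hd τ hτ).hasDerivWithinAt)
    (fun τ hτ => by
      rw [← map_sub, Real.norm_eq_abs]
      exact (hup _).trans (hε τ hτ)) (convex_uIcc 0 t) Set.left_mem_uIcc Set.right_mem_uIcc
  rw [← hu, map_sub, map_sub, huc]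
  refine le_trans (le_of_eq_of_le ?_ (le_abs_self _)) (by simpa using this)
  ring

open scoped ComplexOrder in
-- The gauges of absolutely convex neighbourhoods of 0 generate the topology and are continuous.
-- Local convexity is assumed over ℝ; it passes to ℂ because real and complex convexity of a set
-- coincide.
theorem tendsto_of_forall_seminorm [ContinuousSMul ℂ E] [LocallyConvexSpace ℝ E] {ι : Type*}
    {l : Filter ι} {u : ι → E} {y : E} (h : ∀ p : Seminorm ℂ E, Continuous p → ∀ ε : ℝ, 0 < ε →
      ∀ᶠ x in l, p (u x - y) < ε) : Tendsto u l (𝓝 y) := by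
  have : ContinuousSMul ℝ E := ⟨(continuous_smul (M := ℂ)).comp
    ((Complex.continuous_ofReal.comp continuous_fst).prodMk continuous_snd)⟩
  have : LocallyConvexSpace ℂ E := (locallyConvexSpace_iff_exists_convex_subset_zero ℂ E).2
    fun U hU =>
      let ⟨S, hS, hc, hSU⟩ := (locallyConvexSpace_iff_exists_convex_subset_zero ℝ E).1 ‹_› U hU
      ⟨S, hS, (convex_RCLike_iff_convex_real (K := ℂ)).2 hc, hSU⟩
  have hw := with_gaugeSeminormFamily (𝕜 := ℂ) (E := E)
  exact (hw.tendsto_nhds u y).2 fun i => h _ (hw.continuous_seminorm i)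

end MeanValue

/-! ### Families of partial derivatives, the Leibniz rule, and Cauchy–Riemann. -/

section Jets

variable {E : Type*} [AddCommGroup E] [Module ℂ E] [TopologicalSpace E]

/-- Near `z`, the functions `D i j` behave as the partial derivatives `∂ₓⁱ ∂ᵧʲ` of `D 0 0`. -/
structure JetAt (D : ℕ → ℕ → ℂ → E) (z : ℂ) : Prop where
  cont : ∀ i j, ContinuousAt (D i j) z
  partial_x : ∀ i j, PartialAt 1 (D i j) (D (i + 1) j z) z
  partial_y : ∀ i j, PartialAt Complex.I (D i j) (D i (j + 1) z) z

theorem JetAt.shift_x {D : ℕ → ℕ → ℂ → E} {z : ℂ} (h : JetAt D z) :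
    JetAt (fun i j => D (i + 1) j) z :=
  ⟨fun i j => h.cont (i + 1) j, fun i j => h.partial_x (i + 1) j, fun i j => h.partial_y (i + 1) j⟩

theorem JetAt.shift_y {D : ℕ → ℕ → ℂ → E} {z : ℂ} (h : JetAt D z) :
    JetAt (fun i j => D i (j + 1)) z :=
  ⟨fun i j => h.cont i (j + 1), fun i j => h.partial_x i (j + 1), fun i j => h.partial_y i (j + 1)⟩

/-- This is what allows a product to be extended by zero across the real half-line. -/
theorem JetAt.of_eventuallyEq_zero {D : ℕ → ℕ → ℂ → E} {z : ℂ} (h : ∀ i j, D i j =ᶠ[𝓝 z] 0) :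
    JetAt D z := by
  have h0 : ∀ i j v, PartialAt v (D i j) 0 z := fun i j v =>
    PartialAt.congr (F := 0) (by simpa [PartialAt] using tendsto_const_nhds) (h i j).symm
  refine ⟨fun i j => continuousAt_const.congr (h i j).symm, fun i j => ?_, fun i j => ?_⟩
  · simpa [(h (i + 1) j).self_of_nhds] using h0 i j 1
  · simpa [(h i (j + 1)).self_of_nhds] using h0 i j Complex.I

theorem isJet_of_jetAt {Ω : Opens ℂ} {D : ℕ → ℕ → ℂ → E} (h : ∀ z ∈ Ω, JetAt D z) :
    IsJet (fun z : Ω => D 0 0 z) (fun i j (z : Ω) => D i j z) where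
  zero := rfl
  cont i j := continuous_iff_continuousAt.2 fun z =>
    ((h z z.2).cont i j).comp continuous_subtype_val.continuousAt
  partial_x i j := hasPartial_of_partialAt fun z hz => (h z hz).partial_x i j
  partial_y i j := hasPartial_of_partialAt fun z hz => (h z hz).partial_y i j

theorem ext0_continuousAt {Ω : Opens ℂ} {f : Ω → E} (hf : Continuous f) {z : ℂ} (hz : z ∈ Ω) :
    ContinuousAt (ext0 f) z := by
  rw [← Ω.isOpen.isOpenEmbedding_subtypeVal.continuousAt_iff (x := (⟨z, hz⟩ : Ω))]
  exact hf.continuousAt.congr (Eventually.of_forall fun w => (ext0_coe f w).symm)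

theorem IsJet.jetAt {Ω : Opens ℂ} {f : Ω → E} {D : ℕ → ℕ → Ω → E} (h : IsJet f D) {z : ℂ}
    (hz : z ∈ Ω) : JetAt (fun i j => ext0 (D i j)) z :=
  ⟨fun i j => ext0_continuousAt (h.cont i j) hz, fun i j => (h.partial_x i j).partialAt hz,
    fun i j => (h.partial_y i j).partialAt hz⟩

variable [IsTopologicalAddGroup E] [ContinuousSMul ℂ E]

theorem JetAt.add {D D' : ℕ → ℕ → ℂ → E} {z : ℂ} (h : JetAt D z) (h' : JetAt D' z) :
    JetAt (fun i j => D i j + D' i j) z :=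
  ⟨fun i j => (h.cont i j).add (h'.cont i j), fun i j => (h.partial_x i j).add (h'.partial_x i j),
    fun i j => (h.partial_y i j).add (h'.partial_y i j)⟩

theorem JetAt.const_smul (c : ℂ) {D : ℕ → ℕ → ℂ → E} {z : ℂ} (h : JetAt D z) :
    JetAt (fun i j => c • D i j) z :=
  ⟨fun i j => (h.cont i j).const_smul c, fun i j => (h.partial_x i j).const_smul c,
    fun i j => (h.partial_y i j).const_smul c⟩

/-- The jet of a holomorphic function with complex derivatives `D n`. -/
def holoJet {Ω : Opens ℂ} (D : ℕ → Ω → E) (i j : ℕ) : ℂ → E :=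
  Complex.I ^ j • ext0 (D (i + j))

/-- For a holomorphic function ∂ₓ is d/dz and ∂ᵧ is i d/dz, which accounts for the power of i. -/
theorem jetAt_holoJet {Ω : Opens ℂ} {D : ℕ → Ω → E} (h : ∀ n, HasComplexDeriv (D n) (D (n + 1)))
    {z : ℂ} (hz : z ∈ Ω) : JetAt (holoJet D) z where
  cont i j := ((h (i + j)).complexDerivAt hz).continuousAt.const_smul _
  partial_x i j := by
    have := (((h (i + j)).complexDerivAt hz).partialAt one_ne_zero).const_smul (Complex.I ^ j)
    rwa [one_smul, add_right_comm] at this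
  partial_y i j := by
    have := (((h (i + j)).complexDerivAt hz).partialAt Complex.I_ne_zero).const_smul
      (Complex.I ^ j)
    rwa [smul_smul, ← pow_succ] at this

/-- The partial derivatives of the product of a scalar function with jet `X` and a vector-valued
function with jet `D`. -/
def leibniz (X : ℕ → ℕ → ℂ → ℂ) (D : ℕ → ℕ → ℂ → E) : ℕ → ℕ → ℂ → E
  | 0, 0 => fun z => X 0 0 z • D 0 0 z
  | 0, j + 1 => leibniz (fun i j => X i (j + 1)) D 0 j + leibniz X (fun i j => D i (j + 1)) 0 j
  | i + 1, j => leibniz (fun i j => X (i + 1) j) D i j + leibniz X (fun i j => D (i + 1) j) i j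
termination_by i j => i + j

theorem leibniz_zero (X : ℕ → ℕ → ℂ → ℂ) (D : ℕ → ℕ → ℂ → E) :
    leibniz X D 0 0 = fun z => X 0 0 z • D 0 0 z := by
  rw [leibniz]

theorem leibniz_succ_left (X : ℕ → ℕ → ℂ → ℂ) (D : ℕ → ℕ → ℂ → E) (i j : ℕ) :
    leibniz X D (i + 1) j =
      leibniz (fun i j => X (i + 1) j) D i j + leibniz X (fun i j => D (i + 1) j) i j := by
  rw [leibniz]

/-- The recursion defining `leibniz` removes x-derivatives first. Here a y-derivative is removed at
any stage, which is needed to differentiate in y when i > 0. -/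
theorem leibniz_succ_right (X : ℕ → ℕ → ℂ → ℂ) (D : ℕ → ℕ → ℂ → E) (i j : ℕ) :
    leibniz X D i (j + 1) =
      leibniz (fun i j => X i (j + 1)) D i j + leibniz X (fun i j => D i (j + 1)) i j := by
  induction i generalizing X D with
  | zero => rw [leibniz]
  | succ i ih =>
    rw [leibniz_succ_left, ih, ih, leibniz_succ_left, leibniz_succ_left]
    abel

/-- Induction along the defining recursion of `leibniz`. -/
theorem leibniz_induction {P : (ℕ → ℕ → ℂ → ℂ) → (ℕ → ℕ → ℂ → E) → Prop}
    {Q : ℕ → ℕ → (ℕ → ℕ → ℂ → ℂ) → (ℕ → ℕ → ℂ → E) → Prop}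
    (zero : ∀ X D, P X D → Q 0 0 X D)
    (left : ∀ i j X D, Q i j (fun i j => X (i + 1) j) D → Q i j X (fun i j => D (i + 1) j) →
      Q (i + 1) j X D)
    (right : ∀ i j X D, Q i j (fun i j => X i (j + 1)) D → Q i j X (fun i j => D i (j + 1)) →
      Q i (j + 1) X D)
    (shift : ∀ X D, P X D → P (fun i j => X (i + 1) j) D ∧ P X (fun i j => D (i + 1) j) ∧
      P (fun i j => X i (j + 1)) D ∧ P X (fun i j => D i (j + 1)))
    (i j : ℕ) (X : ℕ → ℕ → ℂ → ℂ) (D : ℕ → ℕ → ℂ → E) (h : P X D) : Q i j X D := by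
  induction i generalizing X D with
  | zero =>
    induction j generalizing X D with
    | zero => exact zero X D h
    | succ j ih => exact right 0 j X D (ih _ _ (shift X D h).2.2.1) (ih _ _ (shift X D h).2.2.2)
  | succ i ih => exact left i j X D (ih _ _ (shift X D h).1) (ih _ _ (shift X D h).2.1)

theorem JetAt.leibniz {X : ℕ → ℕ → ℂ → ℂ} {D : ℕ → ℕ → ℂ → E} {z : ℂ} (hX : JetAt X z)
    (hD : JetAt D z) : JetAt (leibniz X D) z := by
  have key : ∀ i j, ContinuousAt (Hyperfunction.leibniz X D i j) z ∧
      PartialAt 1 (Hyperfunction.leibniz X D i j) (Hyperfunction.leibniz X D (i + 1) j z) z ∧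
      PartialAt Complex.I (Hyperfunction.leibniz X D i j)
        (Hyperfunction.leibniz X D i (j + 1) z) z := by
    intro i j
    refine leibniz_induction (P := fun X D => JetAt X z ∧ JetAt D z)
      (Q := fun i j X D => ContinuousAt (Hyperfunction.leibniz X D i j) z ∧
      PartialAt 1 (Hyperfunction.leibniz X D i j) (Hyperfunction.leibniz X D (i + 1) j z) z ∧
      PartialAt Complex.I (Hyperfunction.leibniz X D i j)
        (Hyperfunction.leibniz X D i (j + 1) z) z) ?_ ?_ ?_ ?_ i j X D ⟨hX, hD⟩
    · rintro X D ⟨hX, hD⟩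
      rw [leibniz_succ_left, leibniz_succ_right, leibniz_zero, leibniz_zero, leibniz_zero,
        leibniz_zero, leibniz_zero]
      exact ⟨(hX.cont 0 0).smul (hD.cont 0 0), (hX.partial_x 0 0).smul (hX.cont 0 0)
        (hD.partial_x 0 0), (hX.partial_y 0 0).smul (hX.cont 0 0) (hD.partial_y 0 0)⟩
    · rintro i j X D ⟨h₁, h₂, h₃⟩ ⟨h₁', h₂', h₃'⟩
      rw [leibniz_succ_left X D i j, leibniz_succ_left X D (i + 1) j,
        leibniz_succ_left X D i (j + 1)]
      exact ⟨h₁.add h₁', h₂.add h₂', h₃.add h₃'⟩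
    · rintro i j X D ⟨h₁, h₂, h₃⟩ ⟨h₁', h₂', h₃'⟩
      rw [leibniz_succ_right X D i j, leibniz_succ_right X D (i + 1) j,
        leibniz_succ_right X D i (j + 1)]
      exact ⟨h₁.add h₁', h₂.add h₂', h₃.add h₃'⟩
    · rintro X D ⟨hX, hD⟩
      exact ⟨⟨hX.shift_x, hD⟩, ⟨hX, hD.shift_x⟩, ⟨hX.shift_y, hD⟩, ⟨hX, hD.shift_y⟩⟩
  exact ⟨fun i j => (key i j).1, fun i j => (key i j).2.1, fun i j => (key i j).2.2⟩

/-- Nothing is asked of `D`, so the vector-valued factor may be singular at z. -/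
theorem leibniz_eventuallyEq_zero {X : ℕ → ℕ → ℂ → ℂ} {z : ℂ} (hX : ∀ i j, X i j =ᶠ[𝓝 z] 0)
    (D : ℕ → ℕ → ℂ → E) (i j : ℕ) : leibniz X D i j =ᶠ[𝓝 z] 0 := by
  refine leibniz_induction (P := fun X _ => ∀ i j, X i j =ᶠ[𝓝 z] 0)
    (Q := fun i j X D => leibniz X D i j =ᶠ[𝓝 z] 0) ?_ ?_ ?_ ?_ i j X D hX
  · intro X D h
    filter_upwards [h 0 0] with w hw
    simp [leibniz_zero, hw]
  · intro i j X D h h'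
    rw [leibniz_succ_left]
    simpa using h.add h'
  · intro i j X D h h'
    rw [leibniz_succ_right]
    simpa using h.add h'
  · exact fun X D h => ⟨fun i j => h (i + 1) j, h, fun i j => h i (j + 1), h⟩

/-- Go from z to z + k along a horizontal and then a vertical segment, and apply the mean value
inequality to each. By Cauchy–Riemann and the continuity of the next derivative, both increments are
linear with the same coefficient, up to o(k). -/
theorem complexDerivAt_of_jetAt [T2Space E] [LocallyConvexSpace ℝ E] {Ω : Opens ℂ}
    {D : ℕ → ℕ → ℂ → E} (hD : ∀ z ∈ Ω, JetAt D z)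
    (h : ∀ z ∈ Ω, D 1 0 z + Complex.I • D 0 1 z = 0) (i : ℕ) :
    ∀ z ∈ Ω, ComplexDerivAt (D i 0) (D (i + 1) 0 z) z := by
  -- The Cauchy–Riemann equation differentiated i times in x, by uniqueness of partial derivatives.
  have hy : ∀ i, ∀ z ∈ Ω, D i 1 z = Complex.I • D (i + 1) 0 z := by
    intro i
    induction i with
    | zero =>
      intro z hz
      rw [eq_neg_of_add_eq_zero_left (h z hz), smul_neg, smul_smul, Complex.I_mul_I, neg_one_smul,
        neg_neg]
    | succ i ih =>
      intro z hz
      refine ((hD z hz).partial_x i 1).unique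
        ((((hD z hz).partial_x (i + 1) 0).const_smul Complex.I).congr ?_)
      filter_upwards [Ω.isOpen.mem_nhds hz] with w hw
      exact (ih w hw).symm
  intro z hz
  refine tendsto_of_forall_seminorm fun p hp ε hε => ?_
  -- With ε / 4 on each segment, the two errors add up to at most (ε / 2)‖k‖.
  have hc : ∀ᶠ w in 𝓝 z, p (D (i + 1) 0 w - D (i + 1) 0 z) < ε / 4 ∧ w ∈ Ω := by
    refine Eventually.and ?_ (Ω.isOpen.mem_nhds hz)
    have : ContinuousAt (fun w => p (D (i + 1) 0 w - D (i + 1) 0 z)) z :=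
      hp.continuousAt.comp (((hD z hz).cont (i + 1) 0).sub continuousAt_const)
    refine this.eventually (gt_mem_nhds ?_)
    simpa using by positivity
  obtain ⟨δ, hδ, hball⟩ := Metric.eventually_nhds_iff.1 hc
  filter_upwards [mem_nhdsWithin_of_mem_nhds (Metric.ball_mem_nhds (0 : ℂ) hδ),
    self_mem_nhdsWithin] with k hk hk0
  rw [Metric.mem_ball, dist_zero_right] at hk
  have hk0' : k ≠ 0 := hk0
  set c := D (i + 1) 0 z
  have habs : ∀ {τ t : ℝ}, τ ∈ Set.uIcc 0 t → |τ| ≤ |t| := fun {τ t} hτ => by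
    simpa using Set.abs_sub_left_of_mem_uIcc hτ
  have hx : p (D i 0 (z + k.re * 1) - D i 0 z - (k.re : ℂ) • c) ≤ ε / 4 * |k.re| := by
    have hm : ∀ τ ∈ Set.uIcc 0 k.re, dist (z + (τ : ℂ) * 1) z < δ := fun τ hτ => by
      rw [mul_one, dist_self_add_left, Complex.norm_real]
      exact ((habs hτ).trans (Complex.abs_re_le_norm k)).trans_lt hk
    exact seminorm_increment_le hp (F' := D (i + 1) 0)
      (fun τ hτ => (hD _ (hball (hm τ hτ)).2).partial_x i 0) (fun τ hτ => (hball (hm τ hτ)).1.le)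
  have hyy : p (D i 0 (z + k.re * 1 + k.im * Complex.I) - D i 0 (z + k.re * 1) -
      (k.im : ℂ) • Complex.I • c) ≤ ε / 4 * |k.im| := by
    -- The vertical segment stays within ‖k‖ of z: its real offset is `k.re`, and its imaginary
    -- offset is at most |`k.im`|.
    have hm : ∀ τ ∈ Set.uIcc 0 k.im, dist (z + (k.re : ℂ) * 1 + τ * Complex.I) z < δ :=
      fun τ hτ => by
      rw [mul_one, add_assoc, dist_self_add_left]
      refine lt_of_le_of_lt ?_ hk
      rw [Complex.norm_def, Complex.norm_def]
      refine Real.sqrt_le_sqrt ?_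
      simp only [Complex.normSq_apply, Complex.add_re, Complex.ofReal_re, Complex.mul_re,
        Complex.I_re, Complex.I_im, Complex.ofReal_im, Complex.add_im, Complex.mul_im]
      have := sq_le_sq.2 (habs hτ)
      nlinarith
    refine seminorm_increment_le hp (F' := D i 1)
      (fun τ hτ => (hD _ (hball (hm τ hτ)).2).partial_y i 0) (fun τ hτ => ?_)
    rw [hy i _ (hball (hm τ hτ)).2, ← smul_sub, map_smul_eq_mul, Complex.norm_I, one_mul]
    exact (hball (hm τ hτ)).1.le
  have hsum : D i 0 (z + k) - D i 0 z - k • c =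
      (D i 0 (z + k.re * 1 + k.im * Complex.I) - D i 0 (z + k.re * 1) -
      (k.im : ℂ) • Complex.I • c) + (D i 0 (z + k.re * 1) - D i 0 z - (k.re : ℂ) • c) := by
    have e1 : z + (k.re : ℂ) * 1 + k.im * Complex.I = z + k := by
      rw [mul_one, add_assoc, Complex.re_add_im]
    have e2 : k • c = (k.re : ℂ) • c + (k.im : ℂ) • Complex.I • c := by
      rw [smul_smul, ← add_smul, Complex.re_add_im]
    rw [e1, e2]
    abel
  have hn : 0 < ‖k‖ := norm_pos_iff.2 hk0'
  have hle : p (D i 0 (z + k) - D i 0 z - k • c) ≤ ε / 2 * ‖k‖ := by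
    rw [hsum]
    refine (map_add_le_add p _ _).trans ((add_le_add hyy hx).trans ?_)
    have h1 := Complex.abs_re_le_norm k
    have h2 := Complex.abs_im_le_norm k
    nlinarith
  have : k⁻¹ • (D i 0 (z + k) - D i 0 z) - c = k⁻¹ • (D i 0 (z + k) - D i 0 z - k • c) := by
    rw [smul_sub _ _ (k • c), smul_smul, inv_mul_cancel₀ hk0', one_smul]
  rw [this, map_smul_eq_mul, norm_inv]
  calc ‖k‖⁻¹ * p (D i 0 (z + k) - D i 0 z - k • c) ≤ ‖k‖⁻¹ * (ε / 2 * ‖k‖) := by gcongr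
    _ = ε / 2 := by field_simp
    _ < ε := by linarith

end Jets

/-! ### Partial derivatives of smooth scalar functions. -/

section ScalarJets

/-- The derivative of a scalar function on the plane in the real direction `v`. -/
def dirDeriv (v : ℂ) (χ : ℂ → ℂ) (z : ℂ) : ℂ := fderiv ℝ χ z v

/-- The partial derivatives of a scalar function. -/
def scalarJet (χ : ℂ → ℂ) (i j : ℕ) : ℂ → ℂ := (dirDeriv 1)^[i] ((dirDeriv Complex.I)^[j] χ)

open scoped ContDiff

theorem contDiff_dirDeriv {χ : ℂ → ℂ} (h : ContDiff ℝ ∞ χ) (v : ℂ) :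
    ContDiff ℝ ∞ (dirDeriv v χ) :=
  (h.fderiv_right (m := ∞) (by simp)).clm_apply contDiff_const

theorem contDiff_iterate_dirDeriv {χ : ℂ → ℂ} (h : ContDiff ℝ ∞ χ) (v : ℂ) (n : ℕ) :
    ContDiff ℝ ∞ ((dirDeriv v)^[n] χ) :=
  Function.Iterate.rec (ContDiff ℝ ∞) h (fun _ h => contDiff_dirDeriv h v) n

/-- Both sides are values of the second Fréchet derivative, which is symmetric. -/
theorem dirDeriv_comm {χ : ℂ → ℂ} (h : ContDiff ℝ ∞ χ) (v w : ℂ) :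
    dirDeriv v (dirDeriv w χ) = dirDeriv w (dirDeriv v χ) := by
  have key : ∀ v w z, dirDeriv v (dirDeriv w χ) z = fderiv ℝ (fderiv ℝ χ) z v w := fun v w z => by
    have hd : DifferentiableAt ℝ (fderiv ℝ χ) z :=
      (h.fderiv_right (m := ∞) (by simp)).differentiable (by simp) z
    have := (hd.hasFDerivAt.clm_apply (hasFDerivAt_const w z)).fderiv
    unfold dirDeriv
    rw [this]
    simp
  ext z
  rw [key, key]
  exact h.contDiffAt.isSymmSndFDerivAt 
    (by rw [minSmoothness_of_isRCLikeNormedField]; exact WithTop.coe_le_coe.2 le_top) v w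

theorem iterate_dirDeriv_comm {χ : ℂ → ℂ} (h : ContDiff ℝ ∞ χ) (v w : ℂ) (n : ℕ) :
    dirDeriv v ((dirDeriv w)^[n] χ) = (dirDeriv w)^[n] (dirDeriv v χ) := by
  induction n with
  | zero => rfl
  | succ n ih =>
    rw [Function.iterate_succ_apply', dirDeriv_comm (contDiff_iterate_dirDeriv h w n), ih,
      ← Function.iterate_succ_apply' (dirDeriv w)]

theorem partialAt_dirDeriv {χ : ℂ → ℂ} (h : ContDiff ℝ ∞ χ) (v z : ℂ) :
    PartialAt v χ (dirDeriv v χ z) z := by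
  have := ((h.differentiable (by simp) z).hasFDerivAt.hasLineDerivAt v).tendsto_slope_zero
  refine this.congr fun t => ?_
  rw [Complex.real_smul, Complex.real_smul, Complex.ofReal_inv, smul_eq_mul]

theorem jetAt_scalarJet {χ : ℂ → ℂ} (h : ContDiff ℝ ∞ χ) (z : ℂ) : JetAt (scalarJet χ) z := by
  have hs : ∀ i j, ContDiff ℝ ∞ (scalarJet χ i j) := fun i j =>
    contDiff_iterate_dirDeriv (contDiff_iterate_dirDeriv h _ j) _ i
  refine ⟨fun i j => (hs i j).continuous.continuousAt, fun i j => ?_, fun i j => ?_⟩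
  · have := partialAt_dirDeriv (hs i j) 1 z
    rwa [scalarJet, ← Function.iterate_succ_apply' (dirDeriv 1)] at this
  · have := partialAt_dirDeriv (hs i j) Complex.I z
    rwa [scalarJet, iterate_dirDeriv_comm (contDiff_iterate_dirDeriv h _ j),
      ← Function.iterate_succ_apply' (dirDeriv Complex.I)] at this

theorem dirDeriv_eventuallyEq_zero {χ : ℂ → ℂ} {z : ℂ} (h : χ =ᶠ[𝓝 z] 0) (v : ℂ) :
    dirDeriv v χ =ᶠ[𝓝 z] 0 := by
  filter_upwards [h.fderiv (𝕜 := ℝ)] with w hw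
  simp [dirDeriv, hw]

theorem scalarJet_eventuallyEq_zero {χ : ℂ → ℂ} {z : ℂ} (h : χ =ᶠ[𝓝 z] 0) (i j : ℕ) :
    scalarJet χ i j =ᶠ[𝓝 z] 0 :=
  have hit : ∀ v n {χ : ℂ → ℂ}, χ =ᶠ[𝓝 z] 0 → (dirDeriv v)^[n] χ =ᶠ[𝓝 z] 0 := fun v n _ h =>
    Function.Iterate.rec (fun χ : ℂ → ℂ => χ =ᶠ[𝓝 z] 0) h
      (fun _ h => dirDeriv_eventuallyEq_zero h v) n
  hit _ _ (hit _ _ h)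

end ScalarJets

open scoped ContDiff

/-! ### Bounds on bounded sets, and the position of S_n(K). -/

section Bounds

variable {E : Type*} [AddCommGroup E] [Module ℂ E] [TopologicalSpace E]

theorem exists_seminorm_bound {B : Set ℂ} (hB : Bornology.IsBounded B) {p : Seminorm ℂ E}
    (hp : Continuous p) {F : ℂ → E} (hF : ∀ z ∈ closure B, ContinuousAt F z) :
    ∃ C : ℝ, 0 ≤ C ∧ ∀ z ∈ B, p (F z) ≤ C := by
  obtain ⟨C, hC⟩ := hB.isCompact_closure.exists_bound_of_continuousOn (f := fun z => p (F z))
    fun z hz => (hp.continuousAt.comp (hF z hz)).continuousWithinAt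
  exact ⟨max C 0, le_max_right _ _, fun z hz =>
    (le_abs_self _).trans ((hC z (subset_closure hz)).trans (le_max_left _ _))⟩

theorem exp_neg_inv_mul_abs_le_one (n : ℕ) (x : ℝ) : Real.exp (-(1 / (n : ℝ)) * |x|) ≤ 1 := by
  rw [Real.exp_le_one_iff, neg_mul, neg_nonpos]
  positivity

theorem mul_exp_le_of_le (p : Seminorm ℂ E) {e : E} {C : ℝ} (h : p e ≤ C) (n : ℕ) (x : ℝ) :
    p e * Real.exp (-(1 / (n : ℝ)) * |x|) ≤ C :=
  (mul_le_of_le_one_right (apply_nonneg p e) (exp_neg_inv_mul_abs_le_one n x)).trans h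

theorem mem_cutPlane {A : Closeds ℝ} {z : ℂ} :
    z ∈ cutPlane A ↔ z ∉ Complex.ofReal '' (A : Set ℝ) :=
  Iff.rfl

theorem mem_cutPlane_of_eq_bot {A : Closeds ℝ} (hA : A = ⊥) (z : ℂ) : z ∈ cutPlane A := by
  simp [mem_cutPlane, hA]

/-- The open 1/n-neighbourhood of K ∩ ℝ is disjoint from S_n(K), so no point of K ∩ ℝ is a limit
point of S_n(K). Functions continuous off K are therefore bounded on bounded parts of S_n(K). -/
theorem closure_stripS_subset {n : ℕ} (hn : 1 ≤ n) (K : Compacts EReal) :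
    closure (stripS n K) ⊆ cutPlane (finitePart K) := by
  intro z hz hzA
  have hmem : z ∈ Metric.thickening (1 / (n : ℝ)) (Complex.ofReal '' (finitePart K : Set ℝ)) :=
    Metric.self_subset_thickening (by positivity) _ hzA
  obtain ⟨w, hw, hw'⟩ := mem_closure_iff.1 hz _ Metric.isOpen_thickening hmem
  exact hw'.1 (subset_closure (Or.inl (Or.inl hw)))

end Bounds

/-! ### Injectivity and surjectivity of the restriction map. -/

section Quotients

variable {E : Type*} [AddCommGroup E] [Module ℂ E] [TopologicalSpace E]
  [IsTopologicalAddGroup E] [ContinuousSMul ℂ E]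

theorem continuousAt_ext0_of_mem_holo {Ω : Opens ℂ} {f : Ω → E} (hf : f ∈ holo E Ω) {z : ℂ}
    (hz : z ∈ Ω) :
    ContinuousAt (ext0 f) z := by
  obtain ⟨D, rfl, hD⟩ := hf
  exact ((hD 0).complexDerivAt hz).continuousAt

/-- The entire extension inherits its growth from the given representative on S_n(K). The rest of
S_n(L) is bounded by `hB`, where continuity suffices. -/
theorem restrictionMap_injective {L K : Compacts EReal} {A : Closeds ℝ} (hLK : L ≤ K)
    (hL : finitePart L = ⊥) (hKA : finitePart K = A)
    (hB : ∀ n : ℕ, 1 ≤ n → Bornology.IsBounded (stripS n L \ stripS n K)) :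
    Function.Injective (restrictionMap E hLK hL hKA.le) := by
  subst hKA
  rw [injective_iff_map_eq_zero]
  intro q hq
  obtain ⟨F, rfl⟩ := Submodule.mkQ_surjective _ q
  have hq' : holoExpToHolo E le_rfl F ∈
      (holoRestrict E (le_top : cutPlane (finitePart K) ≤ ⊤)).range :=
    (Submodule.Quotient.mk_eq_zero _).1 hq
  obtain ⟨G, hG⟩ := hq'
  have hGF : ∀ z : cutPlane (finitePart K), G.1 ⟨z, trivial⟩ = F.1 z :=
    fun z => congrFun (congrArg Subtype.val hG) z
  refine (Submodule.Quotient.mk_eq_zero _).2 ?_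
  refine ⟨⟨restrictFun le_top G.1, restrict_mem_holo E le_top G.2, fun n hn p hp => ?_⟩,
    Subtype.ext (funext fun z => hGF z)⟩
  obtain ⟨C, hC⟩ := F.2.2 n hn p hp
  obtain ⟨C', -, hC'⟩ := exists_seminorm_bound (hB n hn) hp (F := ext0 G.1)
    fun z _ => continuousAt_ext0_of_mem_holo G.2 trivial
  refine ⟨max C C', fun z hz => ?_⟩
  by_cases hzK : (z : ℂ) ∈ stripS n K
  · have hz' := closure_stripS_subset hn K (subset_closure hzK)
    refine le_trans (le_of_eq ?_) ((hC ⟨z, hz'⟩ hzK).trans (le_max_left _ _))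
    rw [← hGF]
    rfl
  · have := hC' z ⟨hz, hzK⟩
    rw [ext0_coe G.1 ⟨z, trivial⟩] at this
    exact mul_exp_le_of_le p (this.trans (le_max_right _ _)) n _

/-- The holomorphic factor is annihilated by ∂ₓ + i∂ᵧ, so only the derivatives of χ survive. -/
theorem leibniz_scalarJet_dbar {Ω : Opens ℂ} (χ : ℂ → ℂ) (D : ℕ → Ω → E) (z : ℂ) :
    leibniz (scalarJet χ) (holoJet D) 1 0 z + Complex.I • leibniz (scalarJet χ) (holoJet D) 0 1 z =
      (dirDeriv 1 χ z + Complex.I * dirDeriv Complex.I χ z) • ext0 (D 0) z := by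
  rw [leibniz_succ_left, leibniz_succ_right]
  simp only [leibniz_zero, scalarJet, holoJet, Pi.add_apply, Pi.smul_apply, smul_add,
    Function.iterate_zero, Function.iterate_succ, id, Function.comp_apply, pow_zero, one_smul,
    add_zero, zero_add, pow_one, add_smul, mul_smul]
  rw [smul_comm Complex.I (χ z), smul_smul Complex.I Complex.I, Complex.I_mul_I]
  simp only [neg_smul, one_smul, smul_neg]
  abel

/-- `∂̄ χ`, for a scalar function `χ`. -/
def scalarDbar (χ : ℂ → ℂ) : ℂ → ℂ :=
  fun z => (1 / 2) * (dirDeriv 1 χ z + Complex.I * dirDeriv Complex.I χ z)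

theorem contDiff_scalarDbar {χ : ℂ → ℂ} (h : ContDiff ℝ ∞ χ) : ContDiff ℝ ∞ (scalarDbar χ) :=
  contDiff_const.mul ((contDiff_dirDeriv h 1).add
    (contDiff_const.mul (contDiff_dirDeriv h Complex.I)))

theorem dirDeriv_one_sub (v : ℂ) (χ : ℂ → ℂ) (z : ℂ) :
    dirDeriv v (1 - χ) z = -dirDeriv v χ z := by
  have : (1 - χ : ℂ → ℂ) = fun w => (1 : ℂ) - χ w := rfl
  rw [dirDeriv, this, fderiv_const_sub]
  rfl

theorem scalarDbar_eventuallyEq_zero {χ : ℂ → ℂ} {z : ℂ} (h : χ =ᶠ[𝓝 z] 0) :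
    scalarDbar χ =ᶠ[𝓝 z] 0 := by
  filter_upwards [dirDeriv_eventuallyEq_zero h 1, dirDeriv_eventuallyEq_zero h Complex.I]
    with w h₁ h₂
  simp [scalarDbar, h₁, h₂]

theorem scalarDbar_one_sub (χ : ℂ → ℂ) : scalarDbar (1 - χ) = -scalarDbar χ := by
  ext z
  simp only [scalarDbar, dirDeriv_one_sub, Pi.neg_apply]
  ring

theorem mem_holo_of_jetAt [T2Space E] [LocallyConvexSpace ℝ E] {Ω : Opens ℂ}
    {D : ℕ → ℕ → ℂ → E} (hD : ∀ z ∈ Ω, JetAt D z)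
    (h : ∀ z ∈ Ω, D 1 0 z + Complex.I • D 0 1 z = 0) : (fun z : Ω => D 0 0 z) ∈ holo E Ω :=
  ⟨fun n z => D n 0 z, rfl,
    fun n => hasComplexDeriv_of_complexDerivAt (complexDerivAt_of_jetAt hD h n)⟩

theorem IsJet.dbar_eq [T2Space E] {Ω : Opens ℂ} {f g : Ω → E} {D : ℕ → ℕ → Ω → E} (hD : IsJet f D)
    (h : IsDbar f g) {z : ℂ} (hz : z ∈ Ω) :
    ext0 (D 1 0) z + Complex.I • ext0 (D 0 1) z = (2 : ℂ) • ext0 g z := by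
  obtain ⟨fx, fy, hx, hy, hg⟩ := h
  have ex : D 1 0 ⟨z, hz⟩ = fx ⟨z, hz⟩ := by
    have := hD.partial_x 0 0 ⟨z, hz⟩
    rw [hD.zero] at this
    exact tendsto_nhds_unique this (hx ⟨z, hz⟩)
  have ey : D 0 1 ⟨z, hz⟩ = fy ⟨z, hz⟩ := by
    have := hD.partial_y 0 0 ⟨z, hz⟩
    rw [hD.zero] at this
    exact tendsto_nhds_unique this (hy ⟨z, hz⟩)
  have e : ∀ F : Ω → E, ext0 F z = F ⟨z, hz⟩ := fun F => ext0_coe F ⟨z, hz⟩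
  rw [e, e, e, ex, ey, hg, smul_smul]
  norm_num

/-- On the bounded set T ∩ S_n(K) every derivative is bounded by compactness, elsewhere it vanishes,
and the exponential weight is at most 1. No growth condition on `D` is needed. -/
theorem isSmoothExp_of_eq_zero {K : Compacts EReal} {T : Set ℂ} {D : ℕ → ℕ → ℂ → E}
    (hD : ∀ z, JetAt D z) (hT : ∀ i j, ∀ z ∉ T, D i j z = 0)
    (hB : ∀ n : ℕ, 1 ≤ n → Bornology.IsBounded (T ∩ stripS n K)) :
    IsSmoothExp K (fun z => D 0 0 z) := by
  refine ⟨fun i j z => D i j z, isJet_of_jetAt fun z _ => hD z, fun n hn m p hp => ?_⟩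
  choose C hC0 hC using fun i j => exists_seminorm_bound (hB n hn) hp (F := D i j)
    fun z _ => (hD z).cont i j
  -- A sum of nonnegative constants dominates each of them, hence serves all i + j ≤ m at once.
  refine ⟨∑ q ∈ Finset.range (m + 1) ×ˢ Finset.range (m + 1), C q.1 q.2, fun z hz i j hij => ?_⟩
  have hle : C i j ≤ ∑ q ∈ Finset.range (m + 1) ×ˢ Finset.range (m + 1), C q.1 q.2 :=
    Finset.single_le_sum (f := fun q : ℕ × ℕ => C q.1 q.2) (fun q _ => hC0 q.1 q.2)
      (a := (i, j)) (by simp; omega)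
  refine mul_exp_le_of_le p (le_trans ?_ hle) n _
  by_cases hzT : (z : ℂ) ∈ T
  · exact hC i j z ⟨hzT, hz⟩
  · change p (D i j z) ≤ C i j
    rw [hT i j z hzT, map_zero]
    exact hC0 i j

/-- Correct the cut-off function ψf by a slowly increasing solution h of ∂̄h = (∂̄ψ)f. As L has no
finite points, h is smooth on all of ℂ. -/
theorem restrictionMap_surjective [T2Space E] [LocallyConvexSpace ℝ E] (hE : Admissible E)
    {L K : Compacts EReal} {A : Closeds ℝ} (hLK : L ≤ K)
    (hL : finitePart L = ⊥) (hKA : finitePart K = A) {ψ : ℂ → ℂ} (hψ : ContDiff ℝ ∞ ψ)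
    (hone : ∀ x ∈ A, ψ =ᶠ[𝓝 (x : ℂ)] 1)
    (hB : ∀ n : ℕ, 1 ≤ n → Bornology.IsBounded (tsupport ψ ∩ stripS n L)) :
    Function.Surjective (restrictionMap E hLK hL hKA.le) := by
  subst hKA
  intro q
  obtain ⟨⟨f, D, hf, hD⟩, rfl⟩ := Submodule.mkQ_surjective _ q
  have hone' : ∀ z ∉ cutPlane (finitePart K), 1 - ψ =ᶠ[𝓝 z] 0 := by
    intro z hz
    obtain ⟨x, hx, rfl⟩ := not_not.1 hz
    filter_upwards [hone x hx] with w hw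
    simp [hw]
  have hsupp : ∀ z ∉ tsupport ψ, ψ =ᶠ[𝓝 z] 0 := fun z hz =>
    notMem_tsupport_iff_eventuallyEq.1 hz
  have hψ' : ContDiff ℝ ∞ (1 - ψ) := contDiff_const.sub hψ
  -- Zero extension: if χ vanishes near K ∩ ℝ, then χf is smooth on the whole plane. It is used for
  -- χ = ∂̄ψ and for χ = 1 - ψ.
  have hjet : ∀ {χ : ℂ → ℂ}, ContDiff ℝ ∞ χ →
      (∀ z ∉ cutPlane (finitePart K), χ =ᶠ[𝓝 z] 0) →
      ∀ z, JetAt (leibniz (scalarJet χ) (holoJet D)) z := by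
    intro χ hχ hχ0 z
    by_cases hz : z ∈ cutPlane (finitePart K)
    · exact (jetAt_scalarJet hχ z).leibniz (jetAt_holoJet hD hz)
    · exact .of_eventuallyEq_zero
        (leibniz_eventuallyEq_zero (scalarJet_eventuallyEq_zero (hχ0 z hz)) _)
  set Jg := leibniz (scalarJet (scalarDbar ψ)) (holoJet D) with hJg
  have hg : IsSmoothExp L (fun z => Jg 0 0 z) := by
    refine isSmoothExp_of_eq_zero (T := tsupport ψ)
      (hjet (contDiff_scalarDbar hψ) fun z hz => ?_) (fun i j z hz => ?_) hB
    -- ∂̄ψ = -∂̄(1 - ψ), and 1 - ψ vanishes near K ∩ ℝ.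
    · have := scalarDbar_eventuallyEq_zero (hone' z hz)
      rw [scalarDbar_one_sub] at this
      simpa using this.neg
    · exact (leibniz_eventuallyEq_zero (scalarJet_eventuallyEq_zero
        (scalarDbar_eventuallyEq_zero (hsupp z hz))) _ i j).self_of_nhds
  obtain ⟨h, ⟨Dh, hDh, hbound⟩, hdbar⟩ := hE L _ hg
  have hmem : ∀ z, z ∈ cutPlane (finitePart L) := mem_cutPlane_of_eq_bot hL
  have hJh : ∀ z, JetAt (fun i j => ext0 (Dh i j)) z := fun z => hDh.jetAt (hmem z)
  have hJg0 : ∀ z, Jg 0 0 z = scalarDbar ψ z • ext0 (D 0) z := fun z => by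
    simp [hJg, leibniz_zero, scalarJet, holoJet]
  have hCR : ∀ z, ext0 (Dh 1 0) z + Complex.I • ext0 (Dh 0 1) z =
      (2 : ℂ) • scalarDbar ψ z • ext0 (D 0) z := fun z => by
    rw [hDh.dbar_eq hdbar (hmem z), ← hJg0, ext0_coe _ ⟨z, hmem z⟩]
  have htwo : ∀ (χ : ℂ → ℂ) z, leibniz (scalarJet χ) (holoJet D) 1 0 z +
      Complex.I • leibniz (scalarJet χ) (holoJet D) 0 1 z =
      (2 : ℂ) • scalarDbar χ z • ext0 (D 0) z := fun χ z => by
    rw [leibniz_scalarJet_dbar, smul_smul, scalarDbar]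
    congr 1
    ring
  -- The partial derivatives of F = ψf - h off K, and below those of the entire function G = (1 -
  -- ψ)f + h = f - F.
  set JF : ℕ → ℕ → ℂ → E := fun i j =>
    leibniz (scalarJet ψ) (holoJet D) i j + (-1 : ℂ) • ext0 (Dh i j) with hJF
  set JG : ℕ → ℕ → ℂ → E := fun i j =>
    leibniz (scalarJet (1 - ψ)) (holoJet D) i j + ext0 (Dh i j) with hJG
  have hF : (fun z : cutPlane (finitePart K) => JF 0 0 z) ∈ holo E (cutPlane (finitePart K)) := by
    refine mem_holo_of_jetAt (fun z hz => ((jetAt_scalarJet hψ z).leibniz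
      (jetAt_holoJet hD hz)).add ((hJh z).const_smul (-1))) fun z _ => ?_
    have h₁ := htwo ψ z
    rw [← hCR z] at h₁
    simp only [hJF, Pi.add_apply, neg_one_smul, Pi.neg_apply, smul_add, smul_neg]
    rw [add_add_add_comm, h₁]
    abel
  have hG : (fun z : (⊤ : Opens ℂ) => JG 0 0 z) ∈ holo E ⊤ := by
    refine mem_holo_of_jetAt (fun z _ => (hjet hψ' hone' z).add (hJh z)) fun z _ => ?_
    have h₁ := htwo (1 - ψ) z
    rw [scalarDbar_one_sub, Pi.neg_apply, neg_smul, smul_neg, ← hCR z] at h₁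
    simp only [hJG, Pi.add_apply, smul_add]
    rw [add_add_add_comm, h₁]
    abel
  have hFG : ∀ z, JF 0 0 z = ext0 (D 0) z - JG 0 0 z := fun z => by
    simp only [hJF, hJG, Pi.add_apply, Pi.neg_apply, leibniz_zero, scalarJet, holoJet,
      Function.iterate_zero, id, pow_zero, one_smul, add_zero, Pi.sub_apply, Pi.one_apply,
      sub_smul, neg_one_smul]
    abel
  have hFexp : (fun z : cutPlane (finitePart K) => JF 0 0 z) ∈ holoExp E K := by
    refine ⟨hF, fun n hn p hp => ?_⟩
    -- ψf is bounded on S_n(K): its support meets S_n(K) in a bounded set whose closure avoids K ∩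
    -- ℝ, where f may be singular.
    obtain ⟨C, hC0, hC⟩ := exists_seminorm_bound (B := tsupport ψ ∩ stripS n K)
      ((hB n hn).subset (Set.inter_subset_inter_right _ (stripS_anti n hLK))) hp
      (F := leibniz (scalarJet ψ) (holoJet D) 0 0) fun z hz =>
        ((jetAt_scalarJet hψ z).leibniz (jetAt_holoJet hD (closure_stripS_subset hn K
          (closure_mono Set.inter_subset_right hz)))).cont 0 0
    obtain ⟨C', hC'⟩ := hbound n hn 0 p hp
    refine ⟨C + C', fun z hz => ?_⟩
    have h₁ : p (leibniz (scalarJet ψ) (holoJet D) 0 0 z) ≤ C := by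
      by_cases hzT : (z : ℂ) ∈ tsupport ψ
      · exact hC z ⟨hzT, hz⟩
      · rw [leibniz_zero]
        simpa [scalarJet, image_eq_zero_of_notMem_tsupport hzT] using hC0
    have h₂ := hC' ⟨z, hmem z⟩ (stripS_anti n hLK hz) 0 0 le_rfl
    rw [← ext0_coe (Dh 0 0)] at h₂
    refine le_trans ?_ (add_le_add (mul_exp_le_of_le p h₁ n (z : ℂ).re) h₂)
    rw [← add_mul]
    refine mul_le_mul_of_nonneg_right ((map_add_le_add p _ _).trans_eq ?_) (Real.exp_pos _).le
    rw [Pi.smul_apply, neg_one_smul, map_neg_eq_map]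
  refine ⟨Submodule.Quotient.mk ⟨_, hFexp⟩, (Submodule.Quotient.eq _).2 ?_⟩
  -- The class of F - f vanishes because F - f = -G extends to an entire function.
  refine ⟨-⟨_, hG⟩, Subtype.ext (funext fun z => ?_)⟩
  change -JG 0 0 z = JF 0 0 z - f z
  rw [hFG, ← hf, ext0_coe]
  abel

end Quotients

/-! ### The exponentially thin cut-off function and the geometry of S_n. -/

section Cutoff

/-- A cut-off function for the half-line `[a, ∞[`: it is `1` near the half-line, and its support is
a neighbourhood of the half-line that becomes exponentially thin at `∞`. -/
def rayCutoff (a : ℝ) (z : ℂ) : ℂ :=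
  ((Real.smoothTransition (2 - 2 * (z.im ^ 2 * Real.exp (2 * z.re))) *
    Real.smoothTransition (2 * (z.re - a) + 2) : ℝ) : ℂ)

theorem contDiff_rayCutoff (a : ℝ) : ContDiff ℝ ∞ (rayCutoff a) := by
  have hre : ContDiff ℝ ∞ Complex.re := Complex.reCLM.contDiff
  have him : ContDiff ℝ ∞ Complex.im := Complex.imCLM.contDiff
  have hs : ContDiff ℝ ∞ Real.smoothTransition := Real.smoothTransition.contDiff
  refine Complex.ofRealCLM.contDiff.comp ((hs.comp ?_).mul (hs.comp ?_))
  · exact contDiff_const.sub (contDiff_const.mul ((him.pow 2).mul (contDiff_const.mul hre).exp))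
  · exact (contDiff_const.mul (hre.sub contDiff_const)).add contDiff_const

theorem rayCutoff_eventuallyEq_one {a x : ℝ} (hx : a ≤ x) : rayCutoff a =ᶠ[𝓝 (x : ℂ)] 1 := by
  have h₁ : ∀ᶠ z : ℂ in 𝓝 (x : ℂ), 1 < 2 - 2 * (z.im ^ 2 * Real.exp (2 * z.re)) := by
    have : Continuous fun z : ℂ => 2 - 2 * (z.im ^ 2 * Real.exp (2 * z.re)) := by fun_prop
    exact this.continuousAt.eventually (lt_mem_nhds (by simp))
  have h₂ : ∀ᶠ z : ℂ in 𝓝 (x : ℂ), 1 < 2 * (z.re - a) + 2 := by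
    have : Continuous fun z : ℂ => 2 * (z.re - a) + 2 := by fun_prop
    exact this.continuousAt.eventually (lt_mem_nhds (by simp; linarith))
  filter_upwards [h₁, h₂] with z hz₁ hz₂
  simp [rayCutoff, Real.smoothTransition.one_of_one_le hz₁.le,
    Real.smoothTransition.one_of_one_le hz₂.le]

theorem tsupport_rayCutoff_subset (a : ℝ) :
    tsupport (rayCutoff a) ⊆ {z | a - 1 ≤ z.re ∧ z.im ^ 2 * Real.exp (2 * z.re) ≤ 1} := by
  refine closure_minimal (fun z hz => ?_) ?_
  · refine ⟨?_, ?_⟩ <;> by_contra! h <;> refine hz ?_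
    · simp [rayCutoff, Real.smoothTransition.zero_of_nonpos (x := 2 * (z.re - a) + 2)
        (by linarith)]
    · simp [rayCutoff, Real.smoothTransition.zero_of_nonpos
        (x := 2 - 2 * (z.im ^ 2 * Real.exp (2 * z.re))) (by linarith)]
  · have h₁ : IsClosed {z : ℂ | a - 1 ≤ z.re} := isClosed_le (by fun_prop) (by fun_prop)
    have h₂ : IsClosed {z : ℂ | z.im ^ 2 * Real.exp (2 * z.re) ≤ 1} :=
      isClosed_le (by fun_prop) (by fun_prop)
    exact h₁.inter h₂

/-- On the support |Im z| ≤ exp(-Re z), and exp(Re z) ≥ Re z + 1 > n. So one cut-off function enters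
the half-strip of U_n({∞}) for every n. -/
theorem abs_im_lt_of_mem_tsupport_rayCutoff {a : ℝ} {z : ℂ} (hz : z ∈ tsupport (rayCutoff a))
    {n : ℕ} (hn : 1 ≤ n) (h : (n : ℝ) ≤ z.re) : |z.im| < 1 / (n : ℝ) := by
  have hn' : (0 : ℝ) < n := by positivity
  have h₁ := (tsupport_rayCutoff_subset a hz).2
  rw [two_mul, Real.exp_add, ← sq, ← mul_pow, sq_le_one_iff_abs_le_one, abs_mul,
    abs_of_pos (Real.exp_pos _)] at h₁
  have h₂ := Real.add_one_le_exp z.re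
  rw [lt_div_iff₀ hn']
  rcases eq_or_lt_of_le (abs_nonneg z.im) with h₀ | h₀
  · rw [← h₀]
    simp
  · nlinarith

theorem isBounded_of_re_im {B : Set ℂ} {a b c d : ℝ}
    (h : ∀ z ∈ B, z.re ∈ Set.Icc a b ∧ z.im ∈ Set.Icc c d) : Bornology.IsBounded B :=
  ((Metric.isBounded_Icc a b).reProdIm (Metric.isBounded_Icc c d)).subset fun z hz => h z hz

/-- The condition |Im z| < n is common to both sets, so a point of the difference lies in the
closure of U_n(K) and in the open complement of the closure of U_n(L). Boundedness can thus be
checked on the explicit sets U_n. -/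
theorem stripS_diff_subset (n : ℕ) (L K : Compacts EReal) :
    stripS n L \ stripS n K ⊆ closure (nhdU n K \ nhdU n L) := by
  rintro z ⟨⟨hzL, hz⟩, hzK⟩
  have hmem : z ∈ closure (nhdU n K) := by
    by_contra h
    exact hzK ⟨h, hz⟩
  have := (isClosed_closure (s := nhdU n L)).isOpen_compl.inter_closure
    (Set.mem_inter hzL hmem)
  refine Set.mem_of_mem_of_subset this (closure_mono ?_)
  exact fun w hw => ⟨hw.2, fun h => hw.1 (subset_closure h)⟩

theorem one_div_natCast_le_one {n : ℕ} (hn : 1 ≤ n) : 1 / (n : ℝ) ≤ 1 := by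
  rw [div_le_one (by positivity)]
  exact_mod_cast hn

theorem abs_im_re_lt_of_mem_thickening {A : Set ℝ} {δ : ℝ} {z : ℂ}
    (hz : z ∈ Metric.thickening δ (Complex.ofReal '' A)) :
    |z.im| < δ ∧ ∃ x ∈ A, |z.re - x| < δ := by
  obtain ⟨_, ⟨x, hx, rfl⟩, hd⟩ := Metric.mem_thickening_iff.1 hz
  rw [Complex.dist_eq] at hd
  have h₁ := (Complex.abs_im_le_norm (z - x)).trans_lt hd
  have h₂ := (Complex.abs_re_le_norm (z - x)).trans_lt hd
  simp only [Complex.sub_im, Complex.ofReal_im, sub_zero, Complex.sub_re,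
    Complex.ofReal_re] at h₁ h₂
  exact ⟨h₁, x, hx, h₂⟩

/-- For Re z > n the 1/n-neighbourhood of [a, ∞[ is contained in the half-strip belonging to ∞, so
U_n([a, ∞]) ∖ U_n({∞}) fits in a rectangle. -/
theorem isBounded_stripS_diff_right (a : ℝ) {n : ℕ} (hn : 1 ≤ n) :
    Bornology.IsBounded (stripS n pointTop \ stripS n (rayRight a)) := by
  refine Bornology.IsBounded.subset ?_ (stripS_diff_subset n pointTop (rayRight a))
  refine Bornology.IsBounded.closure
    (isBounded_of_re_im (a := a - 1) (b := n) (c := -1) (d := 1) ?_)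
  rintro z ⟨(hz | hz) | hz, hzL⟩
  · obtain ⟨him, x, hx, hre⟩ := abs_im_re_lt_of_mem_thickening hz
    rw [finitePart_rayRight] at hx
    have hx' : a ≤ x := hx
    have := one_div_natCast_le_one hn
    refine ⟨⟨by linarith [(abs_lt.1 hre).1], ?_⟩, abs_le.1 (him.le.trans this)⟩
    by_contra! h
    exact hzL (Or.inl (Or.inr ⟨rfl, h, him⟩))
  · exact (hzL (Or.inl (Or.inr (And.intro rfl hz.2)))).elim
  · exact absurd hz.1.1 (by simp)

theorem isBounded_stripS_diff_left (a : ℝ) {n : ℕ} (hn : 1 ≤ n) :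
    Bornology.IsBounded (stripS n pointBot \ stripS n (rayLeft a)) := by
  refine Bornology.IsBounded.subset ?_ (stripS_diff_subset n pointBot (rayLeft a))
  refine Bornology.IsBounded.closure
    (isBounded_of_re_im (a := -n) (b := a + 1) (c := -1) (d := 1) ?_)
  rintro z ⟨(hz | hz) | hz, hzL⟩
  · obtain ⟨him, x, hx, hre⟩ := abs_im_re_lt_of_mem_thickening hz
    rw [finitePart_rayLeft] at hx
    have hx' : x ≤ a := hx
    have := one_div_natCast_le_one hn
    refine ⟨⟨?_, by linarith [(abs_lt.1 hre).2]⟩, abs_le.1 (him.le.trans this)⟩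
    by_contra! h
    exact hzL (Or.inr ⟨rfl, h, him⟩)
  · exact absurd hz.1.2 (by simp)
  · exact (hzL (Or.inr ⟨rfl, hz.2⟩)).elim

theorem isBounded_tsupport_rayCutoff_inter (a : ℝ) {n : ℕ} (hn : 1 ≤ n) :
    Bornology.IsBounded (tsupport (rayCutoff a) ∩ stripS n pointTop) := by
  refine isBounded_of_re_im (a := a - 1) (b := n) (c := -n) (d := n) ?_
  rintro z ⟨hz, hzL, him⟩
  refine ⟨⟨(tsupport_rayCutoff_subset a hz).1, ?_⟩, abs_le.1 (le_of_lt him)⟩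
  by_contra! h
  exact hzL (subset_closure
    (Or.inl (Or.inr ⟨rfl, h, abs_im_lt_of_mem_tsupport_rayCutoff hz hn h.le⟩)))

/-- The left half-line is treated by the reflection z ↦ -z, which turns the cut-off function of [a,
∞[ into one for ]-∞, -a]. -/
theorem isBounded_tsupport_rayCutoff_neg_inter (a : ℝ) {n : ℕ} (hn : 1 ≤ n) :
    Bornology.IsBounded (tsupport (fun z => rayCutoff a (-z)) ∩ stripS n pointBot) := by
  refine isBounded_of_re_im (a := -n) (b := 1 - a) (c := -n) (d := n) ?_
  rintro z ⟨hz, hzL, him⟩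
  have hz' : -z ∈ tsupport (rayCutoff a) := tsupport_comp_subset_preimage _ continuous_neg hz
  have h₁ := (tsupport_rayCutoff_subset a hz').1
  rw [Complex.neg_re] at h₁
  refine ⟨⟨?_, by linarith⟩, abs_le.1 (le_of_lt him)⟩
  by_contra! h
  have h₂ := abs_im_lt_of_mem_tsupport_rayCutoff hz' hn (by rw [Complex.neg_re]; linarith)
  rw [Complex.neg_im, abs_neg] at h₂
  exact hzL (subset_closure (Or.inr ⟨rfl, h, h₂⟩))

theorem rayCutoff_neg_eventuallyEq_one {a x : ℝ} (hx : x ≤ a) :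
    (fun z => rayCutoff (-a) (-z)) =ᶠ[𝓝 (x : ℂ)] 1 := by
  have hc : Tendsto (fun z : ℂ => -z) (𝓝 (x : ℂ)) (𝓝 ((-x : ℝ) : ℂ)) := by
    rw [Complex.ofReal_neg]
    exact continuous_neg.tendsto _
  exact hc.eventually (rayCutoff_eventuallyEq_one (neg_le_neg hx))

end Cutoff

end Hyperfunction

end

theorem mainTheorem11 {E : Type*} [AddCommGroup E] [Module ℂ E] [TopologicalSpace E]
    [IsTopologicalAddGroup E] [ContinuousSMul ℂ E] [LocallyConvexSpace ℝ E] [T2Space E]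
    (hE : Hyperfunction.Admissible E) (a : ℝ) :
    Function.Bijective (Hyperfunction.restrictionRight E a) ∧
      Function.Bijective (Hyperfunction.restrictionLeft E a) := by
  open Hyperfunction in
  exact ⟨⟨restrictionMap_injective _ _ (finitePart_rayRight a)
        fun _ hn => isBounded_stripS_diff_right a hn,
      restrictionMap_surjective hE _ _ (finitePart_rayRight a) (contDiff_rayCutoff a)
        (fun _ hx => rayCutoff_eventuallyEq_one hx)
        fun _ hn => isBounded_tsupport_rayCutoff_inter a hn⟩,
    ⟨restrictionMap_injective _ _ (finitePart_rayLeft a)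
        fun _ hn => isBounded_stripS_diff_left a hn,
      restrictionMap_surjective hE _ _ (finitePart_rayLeft a)
        ((contDiff_rayCutoff (-a)).comp contDiff_neg)
        (fun _ hx => rayCutoff_neg_eventuallyEq_one hx)
        fun _ hn => isBounded_tsupport_rayCutoff_neg_inter (-a) hn⟩⟩
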